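/- Let $\mathbb F$ be a field and let $q\in\mathbb F$ be nonzero and not a root of unity (that is, $q^n\neq 1$ for every integer $n\geq 1$). Let $\hat H_q$ be the universal DAHA of type $(C_1^\vee,C_1)$, i.e. the associative unital $\mathbb F$-algebra defined by generators $t_0^{\pm1},t_1^{\pm1},t_2^{\pm1},t_3^{\pm1}$ and the relations $$t_it_i^{-1}=t_i^{-1}t_i=1,\qquad t_i+t_i^{-1}\ \text{is central}\qquad(0\le i\le 3),\qquad t_0t_1t_2t_3=q^{-1}.$$ For $0\le i\le 3$ put $T_i=t_i+t_i^{-1}$, and let $Z(\hat H_q)$ denote the center of $\hat H_q$. Then: 1. the $\mathbb F$-algebra $Z(\hat H_q)$ is generated by $T_0,T_1,T_2,T_3$; 2. the elements $T_0^\ell T_1^rT_2^sT_3^t$ $(\ell,r,s,t\in\mathbb N=\{0,1,2,\dots\})$ form a basis of the $\mathbb F$-vector space $Z(\hat H_q)$; 3. there exists an isomorphism of $\mathbb F$-algebras $Z(\hat H_q)\to\mathbb F[\lambda_0,\lambda_1,\lambda_2,\lambda_3]$ onto the polynomial algebra in four indeterminates that sends $T_i\mapsto\lambda_i$ for $0\le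 i\le 3$. -/

import Mathlib

/-- The generators `t_i` and `t_i⁻¹`, for `i ∈ {0,1,2,3}`. At this stage `tInv i` is a formal symbol. -/
inductive UDAHAGen : Type
  | t (i : Fin 4) : UDAHAGen
  | tInv (i : Fin 4) : UDAHAGen

/-- The defining relations of the universal DAHA of type `(C₁^∨, C₁)`, as relations between
elements of the free algebra on the generators `t_i`, `t_i⁻¹`. -/
inductive UDAHARel {F : Type*} [Field F] (q : F) :
    FreeAlgebra F UDAHAGen → FreeAlgebra F UDAHAGen → Prop
  | mul_inv (i : Fin 4) :
      UDAHARel q (FreeAlgebra.ι F (UDAHAGen.t i) * FreeAlgebra.ι F (UDAHAGen.tInv i)) 1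
  | inv_mul (i : Fin 4) :
      UDAHARel q (FreeAlgebra.ι F (UDAHAGen.tInv i) * FreeAlgebra.ι F (UDAHAGen.t i)) 1
  | central (i : Fin 4) (x : FreeAlgebra F UDAHAGen) :
      UDAHARel q
        ((FreeAlgebra.ι F (UDAHAGen.t i) + FreeAlgebra.ι F (UDAHAGen.tInv i)) * x)
        (x * (FreeAlgebra.ι F (UDAHAGen.t i) + FreeAlgebra.ι F (UDAHAGen.tInv i)))
  | prod :
      UDAHARel q
        (FreeAlgebra.ι F (UDAHAGen.t 0) * FreeAlgebra.ι F (UDAHAGen.t 1) *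
          FreeAlgebra.ι F (UDAHAGen.t 2) * FreeAlgebra.ι F (UDAHAGen.t 3))
        (algebraMap F (FreeAlgebra F UDAHAGen) q⁻¹)

/-- The universal DAHA `Ĥ_q` of type `(C₁^∨, C₁)`: the `F`-algebra presented by the generators
`t_i`, `t_i⁻¹` and the relations above. -/
abbrev UDAHA {F : Type*} [Field F] (q : F) : Type _ := RingQuot (UDAHARel q)

namespace UDAHA

/-- The element `t_i` of `Ĥ_q`. -/
noncomputable def t {F : Type*} [Field F] (q : F) (i : Fin 4) : UDAHA q :=
  RingQuot.mkAlgHom F (UDAHARel q) (FreeAlgebra.ι F (UDAHAGen.t i))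

/-- The element `t_i⁻¹` of `Ĥ_q`. -/
noncomputable def tInv {F : Type*} [Field F] (q : F) (i : Fin 4) : UDAHA q :=
  RingQuot.mkAlgHom F (UDAHARel q) (FreeAlgebra.ι F (UDAHAGen.tInv i))

/-- The element `T_i = t_i + t_i⁻¹` of `Ĥ_q`. -/
noncomputable def T {F : Type*} [Field F] (q : F) (i : Fin 4) : UDAHA q :=
  t q i + tInv q i

/-- Each `T_i` is central in `Ĥ_q`, directly by the defining relations. -/
theorem T_mem_center {F : Type*} [Field F] (q : F) (i : Fin 4) :
    T q i ∈ Subalgebra.center F (UDAHA q) := by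
  rw [Subalgebra.mem_center_iff]
  intro y
  obtain ⟨x, rfl⟩ := RingQuot.mkAlgHom_surjective F (UDAHARel q) y
  have h := RingQuot.mkAlgHom_rel F (UDAHARel.central (q := q) i x)
  simp only [map_mul, map_add] at h
  exact h.symm

end UDAHA

/-! Put `X = t₃ t₀` and `A = F[T₀, T₁, T₂, T₃]`. Since `t₃ = X t₀⁻¹` and `t₂ = q⁻¹ t₁⁻¹ X⁻¹`, the
algebra is generated over `A` by `t₀`, `t₁` and `X^{±1}`. The relations for `T₃` and `T₂` become `tᵢ
f(X) = (sᵢ f)(X) tᵢ + (δᵢ f)(X)` for `i = 0, 1`, with reflections `s₀ : X ↦ X⁻¹`, `s₁ : X ↦ q⁻² X⁻¹`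
and twisted derivations `δᵢ`. With `tᵢ² = Tᵢ tᵢ - 1`, every element is a sum of terms `fₙ(X) wₙ`,
where `wₙ` runs over the alternating words in `t₀, t₁`, indexed by `ℤ` with length `|n|`.

To make the coefficients `fₙ` visible, these rules are turned into a module `ℤ →₀ A[X^{±1}]`
(`rep`), and `fromRep` sums a coefficient vector back into the algebra. By
`fromRep_rep_single_zero`, `h` is recovered from its action on the vector `1` at index `0`.

Let `z = ∑ fₙ wₙ` be central. The leading term of `wₙ X` is `(wₙ · X) wₙ` (`rep_word_single`), where
`wₙ` acts on `X` through the reflections. As `q` is not a root of unity, `wₙ · X ≠ X` for `n ≠ 0`.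
Comparing `zX` with `Xz` at an index of maximal length kills every `fₙ` with `n ≠ 0`, so `z = f(X)`.
Commuting with `t₀` and `t₁` makes `f` invariant under both reflections, hence under a rescaling of
`X` by `q²`, so `f` is constant: `z` lies in the image of `A`. The map from `A` is injective because
`A` acts faithfully on the module. -/

open scoped LaurentPolynomial

/-! ### Demazure–Lusztig divided differences -/

/-- The data defining a Demazure-Lusztig operator with coefficients in a commutative `A`-algebra
`R`: an involution `s`, a divisor `d` of every `f - s f`, a numerator `p` and a trace `c`. -/
structure DemazureData (A R : Type*) [CommRing A] [CommRing R] [Algebra A R] where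
  s : R →ₐ[A] R
  d : R
  p : R
  c : A
  d_ne_zero : d ≠ 0
  d_dvd : ∀ f, d ∣ f - s f
  s_s : ∀ f, s (s f) = f
  s_d : s d = -d
  p_sub : p - s p = algebraMap A R c * d

namespace DemazureData

variable {A R : Type*} [CommRing A] [CommRing R] [IsDomain R] [Algebra A R]
  (D : DemazureData A R)

/-- The divided difference `f ↦ (f - s f) p / d`. -/
noncomputable def δ : R →ₗ[A] R where
  toFun f := (D.d_dvd f).choose * D.p
  map_add' f g := by
    apply mul_left_cancel₀ D.d_ne_zero
    rw [mul_add, ← mul_assoc, ← mul_assoc, ← mul_assoc, ← (D.d_dvd _).choose_spec,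
      ← (D.d_dvd f).choose_spec, ← (D.d_dvd g).choose_spec, map_add]
    ring
  map_smul' a f := by
    apply mul_left_cancel₀ D.d_ne_zero
    rw [RingHom.id_apply, mul_smul_comm, ← mul_assoc, ← mul_assoc, ← (D.d_dvd _).choose_spec,
      ← (D.d_dvd f).choose_spec, map_smul, Algebra.smul_def, Algebra.smul_def, Algebra.smul_def]
    ring

theorem d_mul_δ (f : R) : D.d * D.δ f = (f - D.s f) * D.p := by
  change D.d * ((D.d_dvd f).choose * D.p) = _
  rw [← mul_assoc, ← (D.d_dvd f).choose_spec]

theorem δ_eq {f g : R} (h : D.d * g = (f - D.s f) * D.p) : D.δ f = g :=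
  mul_left_cancel₀ D.d_ne_zero (by rw [D.d_mul_δ, h])

theorem δ_mul (f g : R) : D.δ (f * g) = D.s f * D.δ g + D.δ f * g := by
  apply D.δ_eq
  have h1 := D.d_mul_δ f
  have h2 := D.d_mul_δ g
  rw [map_mul]
  linear_combination D.s f * h2 + g * h1

theorem δ_algebraMap (a : A) : D.δ (algebraMap A R a) = 0 :=
  D.δ_eq (by simp)

theorem d_mul_s_δ (f : R) : D.d * D.s (D.δ f) = (f - D.s f) * D.s D.p := by
  have h := congrArg D.s (D.d_mul_δ f)
  simp only [map_mul, map_sub, D.s_d, D.s_s] at h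
  linear_combination -h

/-- Since `s d = -d`, after multiplication by `d` the two terms become `-(f - s f) p` and `(f - s f)
s p`; their sum is governed by `p - s p = c d`. -/
theorem δ_s_add (f : R) :
    D.δ (D.s f) + D.s (D.δ f) = algebraMap A R D.c * (D.s f - f) := by
  apply mul_left_cancel₀ D.d_ne_zero
  have h1 := D.d_mul_δ (D.s f)
  have h2 := D.d_mul_s_δ f
  rw [D.s_s] at h1
  linear_combination h1 + h2 - (f - D.s f) * D.p_sub

/-- The same two formulas give `δ f - s (δ f) = c (f - s f)`; multiplying by `p / d` yields the
claim. -/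
theorem δ_δ (f : R) : D.δ (D.δ f) = algebraMap A R D.c * D.δ f := by
  apply D.δ_eq
  have h1 := D.d_mul_δ f
  have h2 := D.d_mul_s_δ f
  apply mul_left_cancel₀ D.d_ne_zero
  linear_combination (algebraMap A R D.c * D.d - D.p) * h1 + D.p * h2 -
    (f - D.s f) * D.p * D.p_sub

end DemazureData

/-! ### Hecke operators on combinations of alternating words -/

/-- A fixed-point-free involution of the index set `ℤ` whose orbits consist of a lower and an
upper point. -/
structure EdgeInvolution where
  σ : ℤ → ℤ
  up : ℤ → Bool
  σ_σ : ∀ n, σ (σ n) = n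
  up_σ : ∀ n, up (σ n) = !up n

namespace EdgeInvolution

/-- The involution with edges `{2k, 2k+1}`. -/
def even : EdgeInvolution where
  -- The index `n` stands for the alternating word of length `|n|`, with rightmost letter `t₀` if `n
  -- > 0` and `t₁` if `n < 0`. Here `σ` adds or removes a leftmost `t₀`, and `up` marks the words
  -- that get longer; `odd` does the same for `t₁`.
  σ n := if n % 2 = 0 then n + 1 else n - 1
  up n := if n % 2 = 0 then decide (0 ≤ n) else decide (n < 0)
  σ_σ n := by grind
  up_σ n := by grind

/-- The involution with edges `{2k-1, 2k}`. -/
def odd : EdgeInvolution where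
  σ n := if n % 2 = 0 then n - 1 else n + 1
  up n := if n % 2 = 0 then decide (n ≤ 0) else decide (0 < n)
  σ_σ n := by grind
  up_σ n := by grind

end EdgeInvolution

/-- Multiplication of all coefficients by an element of `R`. -/
noncomputable def coeffMul (A : Type*) {R : Type*} [CommRing A] [CommRing R] [Algebra A R] :
    R →ₐ[A] Module.End A (ℤ →₀ R) :=
  Algebra.lsmul A A (ℤ →₀ R)

theorem coeffMul_single {A R : Type*} [CommRing A] [CommRing R] [Algebra A R] (g f : R) (n : ℤ) :
    coeffMul A g (Finsupp.single n f) = Finsupp.single n (g * f) := by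
  simp [coeffMul]

namespace DemazureData

variable {A R : Type*} [CommRing A] [CommRing R] [IsDomain R] [Algebra A R]
  (D : DemazureData A R) (e : EdgeInvolution)

/-- The operator of left multiplication by a Hecke generator in the regular representation. -/
noncomputable def op : Module.End A (ℤ →₀ R) :=
  Finsupp.lsum A fun n =>
    -- `single n f` models `f wₙ`, so the rule is `t f wₙ = (s f) t wₙ + (δ f) wₙ`. Here `t wₙ` is
    -- `w_{σ n}` when the word grows, and otherwise `(c - t⁻¹) wₙ = c wₙ - w_{σ n}`.
    (if e.up n then Finsupp.lsingle (e.σ n) ∘ₗ D.s.toLinearMap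
      else Finsupp.lsingle n ∘ₗ (D.c • D.s.toLinearMap) -
        Finsupp.lsingle (e.σ n) ∘ₗ D.s.toLinearMap) + Finsupp.lsingle n ∘ₗ D.δ

theorem op_single_of_up {n : ℤ} (h : e.up n = true) (f : R) :
    D.op e (Finsupp.single n f) =
      Finsupp.single (e.σ n) (D.s f) + Finsupp.single n (D.δ f) := by
  simp [op, h]

theorem op_single_of_not_up {n : ℤ} (h : e.up n = false) (f : R) :
    D.op e (Finsupp.single n f) = Finsupp.single n (algebraMap A R D.c * D.s f) -
      Finsupp.single (e.σ n) (D.s f) + Finsupp.single n (D.δ f) := by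
  simp [op, h, Algebra.smul_def]

theorem op_single_of_not_up' {n : ℤ} (h : e.up n = false) (f : R) :
    D.op e (Finsupp.single n f) = Finsupp.single n (algebraMap A R D.c * D.s f) +
      Finsupp.single (e.σ n) (-D.s f) + Finsupp.single n (D.δ f) := by
  rw [D.op_single_of_not_up e h, Finsupp.single_neg, sub_eq_add_neg]

/-- This is the quadratic relation `t + t⁻¹ = c`; it makes `c - t` a two-sided inverse of `t`. On
each edge it reduces to `δ_s_add` and `δ_δ`. -/
theorem op_mul_op : D.op e * D.op e = D.c • D.op e - 1 := by
  refine Finsupp.lhom_ext fun n f => ?_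
  simp only [Module.End.mul_apply, LinearMap.sub_apply, LinearMap.smul_apply,
    Module.End.one_apply]
  have hc : ∀ (k : ℤ) (g : R), D.c • (Finsupp.single k g : ℤ →₀ R) =
      Finsupp.single k (algebraMap A R D.c * g) := by
    intro k g; rw [Finsupp.smul_single, Algebra.smul_def]
  have h1 := D.δ_s_add f
  have h2 := D.δ_δ f
  cases h : e.up n
  · have h' : e.up (e.σ n) = true := by simp [e.up_σ, h]
    simp only [D.op_single_of_not_up e h, map_add, map_sub, D.op_single_of_up e h', e.σ_σ,
      smul_add, smul_sub, hc, D.s_s, D.δ_mul, D.δ_algebraMap, map_mul, AlgHom.commutes]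
    have e1 : D.δ (D.s f) = algebraMap A R D.c * (D.s f - f) - D.s (D.δ f) := by
      linear_combination h1
    rw [e1, h2]
    simp only [mul_sub, Finsupp.single_sub, zero_mul, add_zero]
    abel
  · have h' : e.up (e.σ n) = false := by simp [e.up_σ, h]
    simp only [D.op_single_of_up e h, map_add, D.op_single_of_not_up e h', e.σ_σ,
      smul_add, hc, D.s_s]
    have e1 : D.δ (D.s f) = algebraMap A R D.c * (D.s f - f) - D.s (D.δ f) := by
      linear_combination h1
    rw [e1, h2]
    simp only [mul_sub, Finsupp.single_sub]
    abel

theorem op_mul_coeffMul (g : R) :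
    D.op e * coeffMul A g = coeffMul A (D.s g) * D.op e + coeffMul A (D.δ g) := by
  refine Finsupp.lhom_ext fun n f => ?_
  simp only [Module.End.mul_apply, LinearMap.add_apply, coeffMul_single]
  cases h : e.up n
  · simp only [D.op_single_of_not_up e h, map_add, map_sub, coeffMul_single, map_mul, D.δ_mul,
      Finsupp.single_add, mul_left_comm]
    abel
  · simp only [D.op_single_of_up e h, map_add, coeffMul_single, map_mul, D.δ_mul,
      Finsupp.single_add]
    abel

end DemazureData

/-! ### Reflections of Laurent polynomials -/

namespace LaurentPolynomial

theorem induction_mul {A : Type*} [CommRing A] {P : A[T;T⁻¹] → Prop} (f : A[T;T⁻¹])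
    (hC : ∀ a, P (C a)) (hT : P (T 1)) (hT' : P (T (-1)))
    (hadd : ∀ f g, P f → P g → P (f + g)) (hmul : ∀ f g, P f → P g → P (f * g)) : P f := by
  refine f.induction_on hC (fun {p q} => hadd p q) (fun n a h => ?_) (fun n a h => ?_)
  · rw [T_add, ← mul_assoc]; exact hmul _ _ h hT
  · rw [T_sub, ← mul_assoc]; exact hmul _ _ h hT'

variable {A : Type*} [CommRing A]

/-- The automorphism `X ↦ u X⁻¹`. -/
noncomputable def reflect (u : Aˣ) : A[T;T⁻¹] →ₐ[A] A[T;T⁻¹] where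
  __ := eval₂ (C : A →+* A[T;T⁻¹])
    ⟨C (u : A) * T (-1), C ((u⁻¹ : Aˣ) : A) * T 1,
      by rw [mul_mul_mul_comm, ← map_mul, ← T_add]; simp,
      by rw [mul_mul_mul_comm, ← map_mul, ← T_add]; simp⟩
  commutes' a := by
    rw [← C_eq_algebraMap]
    exact eval₂_C _ _ a

@[simp]
theorem reflect_C (u : Aˣ) (a : A) : reflect u (C a) = C a := eval₂_C _ _ a

@[simp]
theorem reflect_T_one (u : Aˣ) : reflect u (T 1) = C (u : A) * T (-1) := by
  change eval₂ _ _ (T 1) = _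
  simp [eval₂_T]

@[simp]
theorem reflect_T_neg_one (u : Aˣ) : reflect u (T (-1)) = C ((u⁻¹ : Aˣ) : A) * T 1 := by
  change eval₂ _ _ (T (-1)) = _
  rw [eval₂_T]
  simp

theorem T_mul_T_neg : (T 1 * T (-1) : A[T;T⁻¹]) = 1 := by rw [← T_add]; simp

theorem C_mul_C_inv (u : Aˣ) : (C (u : A) * C ((u⁻¹ : Aˣ) : A) : A[T;T⁻¹]) = 1 := by
  rw [← map_mul]; simp

theorem reflect_reflect (u : Aˣ) (f : A[T;T⁻¹]) : reflect u (reflect u f) = f := by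
  have h := C_mul_C_inv u
  induction f using induction_mul with
  | hC a => simp
  | hT => simp only [reflect_T_one, map_mul, reflect_C, reflect_T_neg_one]
          linear_combination T 1 * h
  | hT' => simp only [reflect_T_one, map_mul, reflect_C, reflect_T_neg_one]
           linear_combination T (-1) * h
  | hadd f g hf hg => rw [map_add, map_add, hf, hg]
  | hmul f g hf hg => rw [map_mul, map_mul, hf, hg]

/-- The operator `f ↦ f - s f` obeys a twisted Leibniz rule, so divisibility passes to products and
need only be checked on `X` and `X⁻¹`. -/
theorem dvd_sub_reflect (u : Aˣ) (f : A[T;T⁻¹]) :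
    T 1 - C (u : A) * T (-1) ∣ f - reflect u f := by
  have h := C_mul_C_inv u
  have hT := T_mul_T_neg (A := A)
  induction f using induction_mul with
  | hC a => simp
  | hT => simp
  | hT' =>
    refine ⟨-C ((u⁻¹ : Aˣ) : A), ?_⟩
    simp only [reflect_T_neg_one]
    linear_combination -T (-1) * h
  | hadd f g hf hg => rw [map_add, add_sub_add_comm]; exact dvd_add hf hg
  | hmul f g hf hg =>
    rw [map_mul, show f * g - reflect u f * reflect u g =
      (f - reflect u f) * g + reflect u f * (g - reflect u g) by ring]
    exact dvd_add (hf.mul_right _) (hg.mul_left _)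

theorem coeff_C_mul_T (a : A) (n k : ℤ) :
    (C a * T n : A[T;T⁻¹]).coeff k = if n = k then a else 0 := by
  rw [← single_eq_C_mul_T]
  exact Finsupp.single_apply

theorem T_sub_ne_zero [Nontrivial A] (u : A) : (T 1 - C u * T (-1) : A[T;T⁻¹]) ≠ 0 := by
  intro h
  have := congrArg (fun f : A[T;T⁻¹] => f.coeff 1) h
  have h1 := coeff_C_mul_T (1 : A) 1 1
  simp only [AddMonoidAlgebra.coeff_sub, Finsupp.sub_apply, coeff_C_mul_T] at this
  simp_all

/-- The Demazure data attached to the reflection `X ↦ u X⁻¹`. -/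
noncomputable def demazureData [Nontrivial A] (u : Aˣ) (p : A[T;T⁻¹]) (c : A)
    (hp : p - reflect u p = C c * (T 1 - C (u : A) * T (-1))) : DemazureData A A[T;T⁻¹] where
  s := reflect u
  d := T 1 - C (u : A) * T (-1)
  p := p
  c := c
  d_ne_zero := T_sub_ne_zero _
  d_dvd := dvd_sub_reflect u
  s_s := reflect_reflect u
  s_d := by
    simp only [map_sub, map_mul, reflect_T_one, reflect_T_neg_one, reflect_C]
    linear_combination -T 1 * C_mul_C_inv u
  p_sub := by rw [hp, C_eq_algebraMap, C_eq_algebraMap]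

end LaurentPolynomial

/-- The twisted Leibniz rule propagates the relation through products, so it suffices to know it for
`X⁻¹`, where the defining relations of the algebra give it directly. -/
theorem RingHom.mul_lift_of_generators {A H : Type*} [CommRing A] [Ring H]
    (φ : A[T;T⁻¹] →+* H) (s : A[T;T⁻¹] →ₐ[A] A[T;T⁻¹]) (δ : A[T;T⁻¹] →ₗ[A] A[T;T⁻¹])
    (t : H) (hδ : ∀ f g, δ (f * g) = s f * δ g + δ f * g)
    (hδC : ∀ a, δ (LaurentPolynomial.C a) = 0)
    (hC : ∀ a, Commute t (φ (LaurentPolynomial.C a)))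
    (h : t * φ (LaurentPolynomial.T (-1)) =
      φ (s (LaurentPolynomial.T (-1))) * t + φ (δ (LaurentPolynomial.T (-1))))
    (f : A[T;T⁻¹]) : t * φ f = φ (s f) * t + φ (δ f) := by
  have hT := LaurentPolynomial.T_mul_T_neg (A := A)
  have hT2 := congrArg φ hT
  rw [map_mul, map_one] at hT2
  have hT2' : φ (LaurentPolynomial.T (-1)) * φ (LaurentPolynomial.T 1) = 1 := by
    rw [← map_mul, mul_comm, hT, map_one]
  induction f using LaurentPolynomial.induction_mul with
  | hC a =>
    rw [hδC, map_zero, add_zero, LaurentPolynomial.C_eq_algebraMap, AlgHom.commutes,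
      ← LaurentPolynomial.C_eq_algebraMap]
    exact hC a
  | hT' => exact h
  | hT =>
    have h1 : s (LaurentPolynomial.T 1) * s (LaurentPolynomial.T (-1)) = 1 := by
      rw [← map_mul, hT, map_one]
    have h2 := hδ (LaurentPolynomial.T 1) (LaurentPolynomial.T (-1))
    rw [hT, ← map_one LaurentPolynomial.C, hδC] at h2
    have h3 := congrArg φ h1
    have h4 := congrArg φ h2
    simp only [map_mul, map_add, map_one, map_zero] at h3 h4
    -- Multiplying the relation for `X⁻¹` by `s X` on the left and by `X` on the right turns it into
    -- the relation for `X`.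
    have h5 := congrArg (fun x => φ (s (LaurentPolynomial.T 1)) * x * φ (LaurentPolynomial.T 1)) h
    have e1 : φ (s (LaurentPolynomial.T 1)) * (t * φ (LaurentPolynomial.T (-1))) *
        φ (LaurentPolynomial.T 1) = φ (s (LaurentPolynomial.T 1)) * t := by
      rw [mul_assoc, mul_assoc, hT2', mul_one]
    have e2 : φ (s (LaurentPolynomial.T 1)) * (φ (s (LaurentPolynomial.T (-1))) * t +
        φ (δ (LaurentPolynomial.T (-1)))) * φ (LaurentPolynomial.T 1) =
        t * φ (LaurentPolynomial.T 1) - φ (δ (LaurentPolynomial.T 1)) := by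
      rw [mul_add, ← mul_assoc, h3, one_mul, eq_neg_of_add_eq_zero_left h4.symm, add_mul,
        neg_mul, mul_assoc, hT2', mul_one, sub_eq_add_neg]
    simp only [e1, e2] at h5
    rw [h5, sub_add_cancel]
  | hadd f g hf hg => simp only [map_add, mul_add, hf, hg, add_mul]; abel
  | hmul f g hf hg =>
    simp only [map_mul, hδ, map_add]
    rw [← mul_assoc, hf, add_mul, mul_assoc, hg, mul_add]
    simp only [mul_assoc]
    abel

namespace LaurentPolynomial

variable {F : Type*} [Field F]

/-- The unit `q⁻²` of the coefficient ring. -/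
noncomputable def qInvSq (q : F) (hq0 : q ≠ 0) : (MvPolynomial (Fin 4) F)ˣ where
  val := .C q⁻¹ ^ 2
  inv := .C q ^ 2
  val_inv := by rw [← mul_pow, ← map_mul, inv_mul_cancel₀ hq0, map_one, one_pow]
  inv_val := by rw [← mul_pow, ← map_mul, mul_inv_cancel₀ hq0, map_one, one_pow]

theorem coe_qInvSq (q : F) (hq0 : q ≠ 0) :
    (qInvSq q hq0 : MvPolynomial (Fin 4) F) = .C q⁻¹ ^ 2 := rfl

theorem coe_inv_qInvSq (q : F) (hq0 : q ≠ 0) :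
    (((qInvSq q hq0)⁻¹ : (MvPolynomial (Fin 4) F)ˣ) : MvPolynomial (Fin 4) F) = .C q ^ 2 := rfl

theorem C_C_mul_C_C_inv (q : F) (hq0 : q ≠ 0) :
    (C (.C q) * C (.C q⁻¹) : (MvPolynomial (Fin 4) F)[T;T⁻¹]) = 1 := by
  rw [← map_mul, ← map_mul, mul_inv_cancel₀ hq0, map_one, map_one]

variable (F) in
/-- The Demazure data of the generator `t₀`. -/
noncomputable def data₀ : DemazureData (MvPolynomial (Fin 4) F) (MvPolynomial (Fin 4) F)[T;T⁻¹] :=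
  -- The numerator is forced by `t₀ X⁻¹ = t₃⁻¹ = X t₀ + T₃ - T₀ X`, since `δ (X⁻¹) = -p` for this
  -- reflection.
  demazureData 1 (C (.X 0) * T 1 - C (.X 3)) (.X 0) (by simp; ring)

/-- The Demazure data of the generator `t₁`. -/
noncomputable def data₁ (q : F) (hq0 : q ≠ 0) :
    DemazureData (MvPolynomial (Fin 4) F) (MvPolynomial (Fin 4) F)[T;T⁻¹] :=
  demazureData (qInvSq q hq0)
    -- Here `T₂ = q⁻¹ t₁⁻¹ X⁻¹ + q X t₁` gives `t₁ X⁻¹ = q² X t₁ + T₁ X⁻¹ - q T₂`, while `δ (X⁻¹) =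
    -- -q² p`.
    (C (.C q⁻¹) * C (.X 2) - C (.C q⁻¹) ^ 2 * C (.X 1) * T (-1)) (.X 1)
    (by
      simp only [map_sub, map_mul, map_pow, reflect_C, reflect_T_neg_one, coe_qInvSq,
        coe_inv_qInvSq]
      linear_combination (C (.X 1) * T 1) * (C (.C q) * C (.C q⁻¹) + 1) * C_C_mul_C_C_inv q hq0)

theorem data₀_s_T_neg_one : (data₀ F).s (T (-1)) = T 1 := by
  simp [data₀, demazureData]

theorem data₁_s_T_neg_one (q : F) (hq0 : q ≠ 0) :
    (data₁ q hq0).s (T (-1)) = C (.C q) ^ 2 * T 1 := by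
  simp [data₁, demazureData, coe_inv_qInvSq]

end LaurentPolynomial

/-! ### Central elements and the commutative subalgebra generated by `X` -/

namespace UDAHA

variable {F : Type*} [Field F] (q : F)

theorem t_mul_tInv (i : Fin 4) : t q i * tInv q i = 1 := by
  simpa [t, tInv] using RingQuot.mkAlgHom_rel F (UDAHARel.mul_inv (q := q) i)

theorem tInv_mul_t (i : Fin 4) : tInv q i * t q i = 1 := by
  simpa [t, tInv] using RingQuot.mkAlgHom_rel F (UDAHARel.inv_mul (q := q) i)

theorem t_prod : t q 0 * t q 1 * t q 2 * t q 3 = algebraMap F (UDAHA q) q⁻¹ := by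
  have h := RingQuot.mkAlgHom_rel F (UDAHARel.prod (q := q))
  rw [map_mul, map_mul, map_mul, AlgHom.commutes] at h
  exact h

theorem T_comm (i : Fin 4) (x : UDAHA q) : T q i * x = x * T q i :=
  (Subalgebra.mem_center_iff.mp (T_mem_center q i) x).symm

/-- The algebra map from polynomials to the center sending the `i`-th variable to `T_i`. -/
noncomputable def polyToCenter : MvPolynomial (Fin 4) F →ₐ[F] Subalgebra.center F (UDAHA q) :=
  MvPolynomial.aeval fun i => ⟨T q i, T_mem_center q i⟩

theorem polyToCenter_X (i : Fin 4) : (polyToCenter q (MvPolynomial.X i) : UDAHA q) = T q i := by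
  simp [polyToCenter]

theorem polyToCenter_comm (a : MvPolynomial (Fin 4) F) (x : UDAHA q) :
    (polyToCenter q a : UDAHA q) * x = x * polyToCenter q a :=
  (Subalgebra.mem_center_iff.mp (polyToCenter q a).2 x).symm

/-- The unit `t₃ t₀`. -/
noncomputable def tUnit : (UDAHA q)ˣ where
  val := t q 3 * t q 0
  inv := tInv q 0 * tInv q 3
  val_inv := by rw [mul_assoc, ← mul_assoc (t q 0), t_mul_tInv, one_mul, t_mul_tInv]
  inv_val := by rw [mul_assoc, ← mul_assoc (tInv q 3), tInv_mul_t, one_mul, tInv_mul_t]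

/-- The ring homomorphism from Laurent polynomials over `F[T₀, T₁, T₂, T₃]` sending the variable
to `t₃ t₀`. -/
noncomputable def laurentHom : (MvPolynomial (Fin 4) F)[T;T⁻¹] →+* UDAHA q :=
  AddMonoidAlgebra.liftNCRingHom
    (((Subalgebra.center F (UDAHA q)).val.comp (polyToCenter q) :
      MvPolynomial (Fin 4) F →ₐ[F] UDAHA q) : MvPolynomial (Fin 4) F →+* UDAHA q)
    ((Units.coeHom (UDAHA q)).comp (zpowersHom (UDAHA q)ˣ (tUnit q)))
    fun a _ => show Commute _ _ from polyToCenter_comm q a _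

theorem laurentHom_C (a : MvPolynomial (Fin 4) F) :
    laurentHom q (LaurentPolynomial.C a) = polyToCenter q a := by
  refine (AddMonoidAlgebra.liftNCRingHom_single _ _ _ 0 a).trans ?_
  simp

theorem laurentHom_T_one : laurentHom q (LaurentPolynomial.T 1) = t q 3 * t q 0 := by
  refine (AddMonoidAlgebra.liftNCRingHom_single _ _ _ 1 1).trans ?_
  simp [tUnit]

theorem laurentHom_T_neg_one :
    laurentHom q (LaurentPolynomial.T (-1)) = tInv q 0 * tInv q 3 := by
  refine (AddMonoidAlgebra.liftNCRingHom_single _ _ _ (-1) 1).trans ?_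
  simp [tUnit]

end UDAHA

/-! ### Building the representation from Demazure data -/

/-- Elements of an `F`-algebra `E` realizing the relations of the double affine Hecke algebra of
type `(C₁^∨, C₁)`: `b₀, b₁` and their inverses realize `t₀, t₁`, while `x` and its inverse `y`
realize `t₃ t₀`, and `c i` realizes `T i`. -/
structure UDAHARealization (F E : Type*) [Field F] [Semiring E] [Algebra F E] (q : F) where
  b₀ : E
  b₀' : E
  b₁ : E
  b₁' : E
  x : E
  y : E
  c : Fin 4 → E
  q_ne_zero : q ≠ 0
  c_comm : ∀ i z, c i * z = z * c i
  b₀_mul : b₀ * b₀' = 1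
  mul_b₀ : b₀' * b₀ = 1
  b₁_mul : b₁ * b₁' = 1
  mul_b₁ : b₁' * b₁ = 1
  x_mul_y : x * y = 1
  y_mul_x : y * x = 1
  b₀_add : b₀ + b₀' = c 0
  b₁_add : b₁ + b₁' = c 1
  c_two : q⁻¹ • (b₁' * y) + q • (x * b₁) = c 2
  c_three : x * b₀' + b₀ * y = c 3

namespace UDAHARealization

variable {F E : Type*} [Field F] [Semiring E] [Algebra F E] {q : F} (D : UDAHARealization F E q)

/-- The images of the generators. -/
def genOp : UDAHAGen → E
  | .t 0 => D.b₀
  | .t 1 => D.b₁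
  | .t 2 => q⁻¹ • (D.b₁' * D.y)
  | .t 3 => D.x * D.b₀'
  | .tInv 0 => D.b₀'
  | .tInv 1 => D.b₁'
  | .tInv 2 => q • (D.x * D.b₁)
  | .tInv 3 => D.b₀ * D.y

theorem genOp_t_mul_tInv (i : Fin 4) : D.genOp (.t i) * D.genOp (.tInv i) = 1 := by
  fin_cases i
  · exact D.b₀_mul
  · exact D.b₁_mul
  · change q⁻¹ • (D.b₁' * D.y) * q • (D.x * D.b₁) = 1
    rw [smul_mul_smul_comm, inv_mul_cancel₀ D.q_ne_zero, one_smul, mul_assoc, ← mul_assoc D.y,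
      D.y_mul_x, one_mul, D.mul_b₁]
  · change D.x * D.b₀' * (D.b₀ * D.y) = 1
    rw [mul_assoc, ← mul_assoc D.b₀', D.mul_b₀, one_mul, D.x_mul_y]

theorem genOp_tInv_mul_t (i : Fin 4) : D.genOp (.tInv i) * D.genOp (.t i) = 1 := by
  fin_cases i
  · exact D.mul_b₀
  · exact D.mul_b₁
  · change q • (D.x * D.b₁) * q⁻¹ • (D.b₁' * D.y) = 1
    rw [smul_mul_smul_comm, mul_inv_cancel₀ D.q_ne_zero, one_smul, mul_assoc, ← mul_assoc D.b₁,
      D.b₁_mul, one_mul, D.x_mul_y]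
  · change D.b₀ * D.y * (D.x * D.b₀') = 1
    rw [mul_assoc, ← mul_assoc D.y, D.y_mul_x, one_mul, D.b₀_mul]

theorem genOp_t_add_tInv (i : Fin 4) : D.genOp (.t i) + D.genOp (.tInv i) = D.c i := by
  fin_cases i
  · exact D.b₀_add
  · exact D.b₁_add
  · exact D.c_two
  · exact D.c_three

theorem genOp_prod : D.genOp (.t 0) * D.genOp (.t 1) * D.genOp (.t 2) * D.genOp (.t 3) =
    algebraMap F E q⁻¹ := by
  change D.b₀ * D.b₁ * q⁻¹ • (D.b₁' * D.y) * (D.x * D.b₀') = _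
  rw [mul_smul_comm, smul_mul_assoc, Algebra.algebraMap_eq_smul_one]
  simp only [mul_assoc]
  rw [← mul_assoc D.y, D.y_mul_x, one_mul, ← mul_assoc D.b₁, D.b₁_mul, one_mul, D.b₀_mul]

/-- The algebra homomorphism induced by a realization. -/
noncomputable def hom : UDAHA q →ₐ[F] E :=
  RingQuot.liftAlgHom F ⟨FreeAlgebra.lift F D.genOp, by
    intro x y h
    induction h with
    | mul_inv i => simpa using D.genOp_t_mul_tInv i
    | inv_mul i => simpa using D.genOp_tInv_mul_t i
    | central i x =>
      simp only [map_mul, map_add, FreeAlgebra.lift_ι_apply, genOp_t_add_tInv]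
      exact D.c_comm _ _
    | prod => simp only [map_mul, FreeAlgebra.lift_ι_apply, genOp_prod, AlgHom.commutes]⟩

theorem hom_t (i : Fin 4) : D.hom (UDAHA.t q i) = D.genOp (.t i) := by
  simp [hom, UDAHA.t]

theorem hom_tInv (i : Fin 4) : D.hom (UDAHA.tInv q i) = D.genOp (.tInv i) := by
  simp [hom, UDAHA.tInv]

theorem hom_t_zero : D.hom (UDAHA.t q 0) = D.b₀ := D.hom_t 0

theorem hom_t_one : D.hom (UDAHA.t q 1) = D.b₁ := D.hom_t 1

theorem hom_T (i : Fin 4) : D.hom (UDAHA.T q i) = D.c i := by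
  rw [UDAHA.T, map_add, hom_t, hom_tInv, genOp_t_add_tInv]

theorem hom_t_three_mul_t_zero : D.hom (UDAHA.t q 3 * UDAHA.t q 0) = D.x := by
  rw [map_mul, hom_t, hom_t]
  change D.x * D.b₀' * D.b₀ = _
  rw [mul_assoc, D.mul_b₀, mul_one]

theorem hom_tInv_zero_mul_tInv_three : D.hom (UDAHA.tInv q 0 * UDAHA.tInv q 3) = D.y := by
  rw [map_mul, hom_tInv, hom_tInv]
  change D.b₀' * (D.b₀ * D.y) = _
  rw [← mul_assoc, D.mul_b₀, one_mul]

end UDAHARealization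

/-- A pair of Demazure data on `R` satisfying the relations of the double affine Hecke algebra of
type `(C₁^∨, C₁)` with traces `c i`, where `x` plays the role of `t₃ t₀`, and `y = x⁻¹`. -/
structure DoubleAffineData (F A R : Type*) [Field F] [CommRing A] [Algebra F A] [CommRing R]
    [Algebra A R] (q : F) where
  D₀ : DemazureData A R
  D₁ : DemazureData A R
  c : Fin 4 → A
  x : R
  y : R
  q_ne_zero : q ≠ 0
  x_mul_y : x * y = 1
  D₀_c : D₀.c = c 0
  D₁_c : D₁.c = c 1
  s₀_y : D₀.s y = x
  s₁_y : D₁.s y = algebraMap A R (algebraMap F A q) ^ 2 * x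
  p₀_mul : (y - x) * D₀.p = D₀.d * (algebraMap A R (c 3) - algebraMap A R (c 0) * x)
  p₁_mul : (y - algebraMap A R (algebraMap F A q) ^ 2 * x) * D₁.p =
    D₁.d * (algebraMap A R (c 1) * y - algebraMap A R (algebraMap F A q) * algebraMap A R (c 2))

namespace DoubleAffineData

variable {F A R : Type*} [Field F] [CommRing A] [Algebra F A] [CommRing R] [IsDomain R]
  [Algebra A R] {q : F} (D : DoubleAffineData F A R q)

theorem δ₀_y : D.D₀.δ D.y = algebraMap A R (D.c 3) - algebraMap A R (D.c 0) * D.x :=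
  D.D₀.δ_eq (by rw [D.s₀_y, D.p₀_mul])

theorem δ₁_y : D.D₁.δ D.y = algebraMap A R (D.c 1) * D.y -
    algebraMap A R (algebraMap F A q) * algebraMap A R (D.c 2) :=
  D.D₁.δ_eq (by rw [D.s₁_y, D.p₁_mul])

theorem _root_.DemazureData.op_op_apply (D : DemazureData A R) (e : EdgeInvolution) (m : ℤ →₀ R) :
    D.op e (D.op e m) = D.c • D.op e m - m :=
  congrArg (fun f => f m) (D.op_mul_op e)

theorem _root_.DemazureData.op_smul (D : DemazureData A R) (e : EdgeInvolution) (g : R)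
    (m : ℤ →₀ R) : D.op e (g • m) = D.s g • D.op e m + D.δ g • m :=
  congrArg (fun f => f m) (D.op_mul_coeffMul e g)

theorem _root_.DemazureData.op_mul_inv (D : DemazureData A R) (e : EdgeInvolution) :
    D.op e * (algebraMap A (Module.End A (ℤ →₀ R)) D.c - D.op e) = 1 := by
  refine LinearMap.ext fun m => ?_
  rw [Module.End.mul_apply, LinearMap.sub_apply, map_sub, Module.algebraMap_end_apply, map_smul,
    D.op_op_apply, sub_sub_cancel, Module.End.one_apply]

theorem _root_.DemazureData.inv_mul_op (D : DemazureData A R) (e : EdgeInvolution) :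
    (algebraMap A (Module.End A (ℤ →₀ R)) D.c - D.op e) * D.op e = 1 := by
  refine LinearMap.ext fun m => ?_
  rw [Module.End.mul_apply, LinearMap.sub_apply, Module.algebraMap_end_apply,
    D.op_op_apply, sub_sub_cancel, Module.End.one_apply]

variable [Algebra F R] [IsScalarTower F A R]

/-- The regular representation. -/
noncomputable def realization : UDAHARealization F (Module.End A (ℤ →₀ R)) q where
  b₀ := D.D₀.op .even
  b₀' := algebraMap A _ (D.c 0) - D.D₀.op .even
  b₁ := D.D₁.op .odd
  b₁' := algebraMap A _ (D.c 1) - D.D₁.op .odd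
  x := coeffMul A D.x
  y := coeffMul A D.y
  c i := algebraMap A _ (D.c i)
  q_ne_zero := D.q_ne_zero
  c_comm i z := Algebra.commutes _ _
  b₀_mul := D.D₀_c ▸ D.D₀.op_mul_inv _
  mul_b₀ := D.D₀_c ▸ D.D₀.inv_mul_op _
  b₁_mul := D.D₁_c ▸ D.D₁.op_mul_inv _
  mul_b₁ := D.D₁_c ▸ D.D₁.inv_mul_op _
  x_mul_y := by rw [← map_mul, D.x_mul_y, map_one]
  y_mul_x := by rw [← map_mul, mul_comm, D.x_mul_y, map_one]
  b₀_add := LinearMap.ext fun m => add_sub_cancel _ _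
  b₁_add := LinearMap.ext fun m => add_sub_cancel _ _
  c_two := by
    have hq : algebraMap F A q⁻¹ * algebraMap F A q = 1 := by
      rw [← map_mul, inv_mul_cancel₀ D.q_ne_zero, map_one]
    refine LinearMap.ext fun m => ?_
    change q⁻¹ • (D.c 1 • D.y • m - D.D₁.op .odd (D.y • m)) + q • D.x • D.D₁.op .odd m = D.c 2 • m
    have hq' := congrArg (algebraMap A R) hq
    rw [map_mul, map_one] at hq'
    -- With `k = q` and `k' = q⁻¹`, expanding `t₁ y` leaves a module identity that uses only `k' k =
    -- 1`.
    have key : ∀ (k k' c₁ c₂ : R) (o : ℤ →₀ R), k' * k = 1 →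
        k' • (c₁ • D.y • m - ((k ^ 2 * D.x) • o + (c₁ * D.y - k * c₂) • m)) + k • D.x • o =
          c₂ • m := by
      intro k k' c₁ c₂ o h
      linear_combination (norm := module) h • (c₂ • m) - h • ((k * D.x) • o)
    rw [D.D₁.op_smul, D.s₁_y, D.δ₁_y, ← algebraMap_smul A q⁻¹, ← algebraMap_smul A q,
      ← algebraMap_smul R (D.c 1), ← algebraMap_smul R (D.c 2),
      ← algebraMap_smul R (algebraMap F A q⁻¹), ← algebraMap_smul R (algebraMap F A q)]
    exact key _ _ _ _ _ hq'
  c_three := by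
    refine LinearMap.ext fun m => ?_
    change D.x • (D.c 0 • m - D.D₀.op .even m) + D.D₀.op .even (D.y • m) = D.c 3 • m
    rw [D.D₀.op_smul, D.s₀_y, D.δ₀_y, smul_sub, sub_smul, mul_smul, algebraMap_smul,
      algebraMap_smul, smul_comm D.x]
    abel

end DoubleAffineData

/-! ### Coefficients and leading terms -/

namespace LaurentPolynomial

theorem reflect_coeff {A : Type*} [CommRing A] (u : Aˣ) (f : A[T;T⁻¹]) (k : ℤ) :
    (reflect u f).coeff k = ((u ^ (-k) : Aˣ) : A) * f.coeff (-k) := by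
  induction f using LaurentPolynomial.induction_on' with
  | add p q hp hq =>
    rw [map_add, AddMonoidAlgebra.coeff_add, Finsupp.add_apply, hp, hq,
      AddMonoidAlgebra.coeff_add, Finsupp.add_apply, mul_add]
  | C_mul_T n a =>
    have h : ∀ n : ℤ, reflect u (T n) = C ((u ^ n : Aˣ) : A) * T (-n) := by
      intro n
      induction n using Int.induction_on with
      | zero => simp
      | succ i ih =>
        rw [T_add, map_mul, ih, reflect_T_one, zpow_add_one, Units.val_mul, map_mul, neg_add, T_add]
        ring
      | pred i ih =>
        rw [T_sub, map_mul, ih, reflect_T_neg_one, zpow_sub_one, Units.val_mul, map_mul, neg_sub',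
          sub_neg_eq_add, T_add]
        ring
    rw [map_mul, reflect_C, h, ← mul_assoc, ← map_mul, coeff_C_mul_T, coeff_C_mul_T]
    split_ifs with h1 h2 h2
    · subst h1; rw [neg_neg, mul_comm]
    · omega
    · omega
    · rw [mul_zero]

end LaurentPolynomial

namespace EdgeInvolution

theorem natAbs_even_σ {n : ℤ} (h : even.up n = true) : (even.σ n).natAbs = n.natAbs + 1 := by
  simp only [even] at *; grind

theorem natAbs_odd_σ {n : ℤ} (h : odd.up n = true) : (odd.σ n).natAbs = n.natAbs + 1 := by
  simp only [odd] at *; grind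

theorem natAbs_le_σ (e : EdgeInvolution) (he : ∀ n, e.up n = true →
    (e.σ n).natAbs = n.natAbs + 1) (n : ℤ) : n.natAbs ≤ (e.σ n).natAbs + 1 := by
  cases h : e.up n
  · have := he (e.σ n) (by simp [e.up_σ, h])
    rw [e.σ_σ] at this
    exact this.le
  · have := he n h
    omega

theorem not_up_even_or_odd {n : ℤ} (hn : n ≠ 0) : even.up n = false ∨ odd.up n = false := by
  simp only [even, odd]; grind

end EdgeInvolution

namespace DemazureData

variable {A R : Type*} [CommRing A] [CommRing R] [IsDomain R] [Algebra A R]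
  (D : DemazureData A R) (e : EdgeInvolution)

theorem op_apply (m : ℤ →₀ R) (k : ℤ) : D.op e m k = D.δ (m k) +
    if e.up k then -D.s (m (e.σ k)) else algebraMap A R D.c * D.s (m k) + D.s (m (e.σ k)) := by
  induction m using Finsupp.induction_linear with
  | zero => simp
  | add m m' h h' =>
    simp only [map_add, Finsupp.add_apply, h, h']
    split_ifs <;> ring
  | single n f =>
    have hσ : e.σ n = k ↔ n = e.σ k := ⟨fun h => by rw [← h, e.σ_σ], fun h => by rw [h, e.σ_σ]⟩
    have hne : e.σ k ≠ k := fun h => by simpa [h] using e.up_σ k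
    have hup := e.up_σ k
    cases h : e.up n
    · rw [op_single_of_not_up _ _ h]
      simp only [Finsupp.add_apply, Finsupp.sub_apply, Finsupp.single_apply, hσ]
      by_cases h1 : n = k
      · subst h1; simp [h, hne.symm]; ring
      · by_cases h2 : n = e.σ k
        · subst h2; simp_all
        · simp [h1, h2]
    · rw [op_single_of_up _ _ h]
      simp only [Finsupp.add_apply, Finsupp.single_apply, hσ]
      by_cases h1 : n = k
      · subst h1; simp [h, hne.symm]
      · by_cases h2 : n = e.σ k
        · subst h2; simp_all
        · simp [h1, h2]

/-- Leading terms with respect to word length are transformed by the reflection. -/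
theorem op_leading_term (he : ∀ n, e.up n = true → (e.σ n).natAbs = n.natAbs + 1) {n : ℤ}
    (h : e.up n = true) (g : R) {m : ℤ →₀ R} (hm : ∀ k : ℤ, n.natAbs ≤ k.natAbs → m k = 0) :
    ∃ m' : ℤ →₀ R, D.op e (Finsupp.single n g + m) = Finsupp.single (e.σ n) (D.s g) + m' ∧
      ∀ k : ℤ, (e.σ n).natAbs ≤ k.natAbs → m' k = 0 := by
  -- Both remainder terms are shorter than `σ n`: the first sits at `n`, and the operator lengthens
  -- the support of `m` by at most one.
  refine ⟨Finsupp.single n (D.δ g) + D.op e m, ?_, fun k hk => ?_⟩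
  · rw [map_add, D.op_single_of_up e h, add_assoc]
  · have h1 := e.natAbs_le_σ he k
    rw [he n h] at hk
    have h2 : n ≠ k := by rintro rfl; omega
    rw [Finsupp.add_apply, D.op_apply, Finsupp.single_apply, if_neg h2, hm k (by omega),
      hm (e.σ k) (by omega)]
    simp

end DemazureData

/-! ### The regular representation and the commutation relations -/

namespace UDAHA

open LaurentPolynomial

variable {F : Type*} [Field F] (q : F) (hq0 : q ≠ 0)

/-- The Demazure data on Laurent polynomials defining the regular representation. -/
noncomputable def laurentData :
    DoubleAffineData F (MvPolynomial (Fin 4) F) (MvPolynomial (Fin 4) F)[T;T⁻¹] q where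
  D₀ := data₀ F
  D₁ := data₁ q hq0
  c := MvPolynomial.X
  x := LaurentPolynomial.T 1
  y := LaurentPolynomial.T (-1)
  q_ne_zero := hq0
  x_mul_y := T_mul_T_neg
  D₀_c := rfl
  D₁_c := rfl
  s₀_y := data₀_s_T_neg_one
  s₁_y := data₁_s_T_neg_one q hq0
  p₀_mul := by
    simp only [data₀, demazureData, Units.val_one, map_one, ← C_eq_algebraMap]
    ring
  p₁_mul := by
    simp only [data₁, demazureData, coe_qInvSq, map_pow, ← C_eq_algebraMap,
      MvPolynomial.algebraMap_eq]
    have h := C_C_mul_C_C_inv q hq0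
    set x : (MvPolynomial (Fin 4) F)[T;T⁻¹] := C (.C q)
    set y : (MvPolynomial (Fin 4) F)[T;T⁻¹] := C (.C q⁻¹)
    linear_combination (-C (.X 2) * LaurentPolynomial.T 1 * x -
      y * C (.X 2) * LaurentPolynomial.T (-1) +
      C (.X 1) * LaurentPolynomial.T 1 * LaurentPolynomial.T (-1) * (x * y + 1)) * h

/-- The regular representation. -/
noncomputable def rep : UDAHA q →ₐ[F]
    Module.End (MvPolynomial (Fin 4) F) (ℤ →₀ (MvPolynomial (Fin 4) F)[T;T⁻¹]) :=
  (laurentData q hq0).realization.hom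

theorem rep_t_zero : rep q hq0 (t q 0) = (data₀ F).op .even :=
  (laurentData q hq0).realization.hom_t_zero

theorem rep_t_one : rep q hq0 (t q 1) = (data₁ q hq0).op .odd :=
  (laurentData q hq0).realization.hom_t_one

theorem rep_polyToCenter (a : MvPolynomial (Fin 4) F) :
    rep q hq0 (polyToCenter q a) = coeffMul (MvPolynomial (Fin 4) F) (C a) := by
  induction a using MvPolynomial.induction_on with
  | C r =>
    rw [← MvPolynomial.algebraMap_eq, AlgHom.commutes, C_eq_algebraMap, AlgHom.commutes]
    refine ((rep q hq0).commutes r).trans ?_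
    exact LinearMap.ext fun m => (algebraMap_smul (MvPolynomial (Fin 4) F) r m).symm
  | add a b ha hb => simp only [map_add, Subalgebra.coe_add, ha, hb]
  | mul_X a i ha =>
    rw [map_mul, map_mul, map_mul, Subalgebra.coe_mul, map_mul, polyToCenter_X, ha]
    congr 1
    refine ((laurentData q hq0).realization.hom_T i).trans ?_
    rw [C_eq_algebraMap, AlgHom.commutes]
    rfl

theorem rep_laurentHom (f : (MvPolynomial (Fin 4) F)[T;T⁻¹]) :
    rep q hq0 (laurentHom q f) = coeffMul (MvPolynomial (Fin 4) F) f := by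
  induction f using LaurentPolynomial.induction_mul with
  | hC a => rw [laurentHom_C, rep_polyToCenter]
  | hT =>
    rw [laurentHom_T_one]
    exact (laurentData q hq0).realization.hom_t_three_mul_t_zero
  | hT' =>
    rw [laurentHom_T_neg_one]
    exact (laurentData q hq0).realization.hom_tInv_zero_mul_tInv_three
  | hadd f g hf hg => simp only [map_add, hf, hg]
  | hmul f g hf hg => simp only [map_mul, hf, hg]

theorem laurentHom_C_X (i : Fin 4) : laurentHom q (C (MvPolynomial.X i)) = T q i := by
  rw [laurentHom_C, polyToCenter_X]

theorem laurentHom_C_C (r : F) : laurentHom q (C (MvPolynomial.C r)) = algebraMap F _ r := by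
  rw [laurentHom_C, ← MvPolynomial.algebraMap_eq, AlgHom.commutes]
  rfl

theorem tInv_two (hq0 : q ≠ 0) :
    tInv q 2 = algebraMap F (UDAHA q) q * (t q 3 * t q 0 * t q 1) := by
  have h1 : t q 0 * t q 1 * t q 2 = algebraMap F (UDAHA q) q⁻¹ * tInv q 3 := by
    rw [← t_prod, mul_assoc _ (t q 3), t_mul_tInv, mul_one]
  have h2 : t q 3 * t q 0 * t q 1 * t q 2 = algebraMap F (UDAHA q) q⁻¹ := by
    rw [mul_assoc (t q 3), mul_assoc (t q 3), h1, Algebra.commutes, ← mul_assoc, t_mul_tInv,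
      one_mul]
  have h3 : t q 3 * t q 0 * t q 1 = algebraMap F (UDAHA q) q⁻¹ * tInv q 2 := by
    rw [← h2, mul_assoc _ (t q 2), t_mul_tInv, mul_one]
  rw [h3, ← mul_assoc, ← map_mul, mul_inv_cancel₀ hq0, map_one, one_mul]

theorem q_mul_t_two (hq0 : q ≠ 0) :
    algebraMap F (UDAHA q) q * t q 2 = tInv q 1 * (tInv q 0 * tInv q 3) := by
  have h := tInv_mul_t q 2
  rw [tInv_two q hq0, Algebra.commutes, mul_assoc _ _ (t q 2)] at h
  calc algebraMap F (UDAHA q) q * t q 2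
      = tInv q 1 * (tInv q 0 * (tInv q 3 * (t q 3 * (t q 0 *
          (t q 1 * (algebraMap F (UDAHA q) q * t q 2)))))) := by
        rw [← mul_assoc (tInv q 3), tInv_mul_t, one_mul, ← mul_assoc (tInv q 0), tInv_mul_t,
          one_mul, ← mul_assoc (tInv q 1), tInv_mul_t, one_mul]
    _ = _ := by
        rw [← mul_assoc (t q 0), ← mul_assoc (t q 3), ← mul_assoc (t q 3), h, mul_one]

/-- On `X⁻¹` this is the expansion of `T₃ = X t₀⁻¹ + t₀ X⁻¹`. It shows that the relations used to
build the module already hold in the algebra. -/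
theorem t_zero_mul_laurentHom (hq0 : q ≠ 0) (f : (MvPolynomial (Fin 4) F)[T;T⁻¹]) :
    t q 0 * laurentHom q f =
      laurentHom q ((data₀ F).s f) * t q 0 + laurentHom q ((data₀ F).δ f) := by
  refine RingHom.mul_lift_of_generators _ _ _ _ (DemazureData.δ_mul _)
    (DemazureData.δ_algebraMap _) (fun a => ?_) ?_ f
  · rw [laurentHom_C]; exact (polyToCenter_comm q a _).symm
  · have h1 := (laurentData q hq0).s₀_y
    have h2 := (laurentData q hq0).δ₀_y
    simp only [laurentData, ← C_eq_algebraMap] at h1 h2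
    rw [h1, h2, map_sub, map_mul, laurentHom_C_X, laurentHom_C_X, laurentHom_T_one,
      laurentHom_T_neg_one, T_comm, ← mul_assoc, t_mul_tInv, one_mul, T, T, mul_add,
      mul_assoc _ (t q 0) (tInv q 0), t_mul_tInv, mul_one]
    abel

theorem t_one_mul_laurentHom (f : (MvPolynomial (Fin 4) F)[T;T⁻¹]) :
    t q 1 * laurentHom q f =
      laurentHom q ((data₁ q hq0).s f) * t q 1 + laurentHom q ((data₁ q hq0).δ f) := by
  refine RingHom.mul_lift_of_generators _ _ _ _ (DemazureData.δ_mul _)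
    (DemazureData.δ_algebraMap _) (fun a => ?_) ?_ f
  · rw [laurentHom_C]; exact (polyToCenter_comm q a _).symm
  · have h1 := (laurentData q hq0).s₁_y
    have h2 := (laurentData q hq0).δ₁_y
    simp only [laurentData, ← C_eq_algebraMap, MvPolynomial.algebraMap_eq] at h1 h2
    rw [h1, h2, map_sub, map_mul, map_mul, map_mul, map_pow, laurentHom_C_C, laurentHom_C_X,
      laurentHom_C_X, laurentHom_T_one, laurentHom_T_neg_one, T, T, mul_add, q_mul_t_two q hq0,
      tInv_two q hq0, pow_two]
    simp only [add_mul, mul_assoc]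
    abel

end UDAHA

theorem RingHom.map_neg_mul {R S : Type*} [Ring R] [Ring S] (φ : R →+* S) (a : R) (b : S) :
    φ (-a) * b = -(φ a * b) := by
  rw [map_neg, neg_mul]

theorem add_algebraMap_neg_one_mul {R S : Type*} [CommRing R] [Ring S] [Algebra R S] (a b : S) :
    a + algebraMap R S (-1) * b = a - b := by
  rw [map_neg, map_one, neg_one_mul, sub_eq_add_neg]

/-! ### Recovering an element from its action -/

namespace UDAHA

open LaurentPolynomial

variable {F : Type*} [Field F] (q : F) (hq0 : q ≠ 0)

/-- The alternating word of length `n` in `a` and `b` whose rightmost letter is `a`. -/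
def altWord {M : Type*} [Monoid M] (a b : M) : ℕ → M
  | 0 => 1
  | n + 1 => (if n % 2 = 0 then a else b) * altWord a b n

/-- The alternating words in `t₀` and `t₁`, indexed by the integers. -/
noncomputable def word (n : ℤ) : UDAHA q :=
  if 0 ≤ n then altWord (t q 0) (t q 1) n.natAbs else altWord (t q 1) (t q 0) n.natAbs

theorem word_zero : word q 0 = 1 := by simp [word, altWord]

theorem word_even_σ {n : ℤ} (h : EdgeInvolution.even.up n = true) :
    word q (EdgeInvolution.even.σ n) = t q 0 * word q n := by
  have h1 := EdgeInvolution.natAbs_even_σ h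
  rw [word, word, h1, altWord, altWord]
  simp only [EdgeInvolution.even] at h ⊢
  rcases Int.emod_two_eq_zero_or_one n with h2 | h2
  · have h3 : n.natAbs % 2 = 0 := by omega
    simp only [h2, if_true, decide_eq_true_eq] at h ⊢
    rw [if_pos (by omega), if_pos h3, if_pos h]
  · have h3 : n.natAbs % 2 ≠ 0 := by omega
    simp only [h2, one_ne_zero, if_false, decide_eq_true_eq] at h ⊢
    rw [if_neg (by omega), if_neg h3, if_neg (by omega)]

theorem word_odd_σ {n : ℤ} (h : EdgeInvolution.odd.up n = true) :
    word q (EdgeInvolution.odd.σ n) = t q 1 * word q n := by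
  have h1 := EdgeInvolution.natAbs_odd_σ h
  rw [word, word, h1, altWord, altWord]
  simp only [EdgeInvolution.odd] at h ⊢
  rcases Int.emod_two_eq_zero_or_one n with h2 | h2
  · have h3 : n.natAbs % 2 = 0 := by omega
    simp only [h2, if_true, decide_eq_true_eq] at h ⊢
    rw [if_neg (by omega), if_pos h3]
    split_ifs with h4
    · obtain rfl : n = 0 := by omega
      rfl
    · rfl
  · have h3 : n.natAbs % 2 ≠ 0 := by omega
    simp only [h2, one_ne_zero, if_false, decide_eq_true_eq] at h ⊢
    rw [if_pos (by omega), if_neg h3, if_pos (by omega)]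

theorem t_mul_of_not_up (e : EdgeInvolution) (i : Fin 4)
    (he : ∀ n, e.up n = true → word q (e.σ n) = t q i * word q n) {n : ℤ} (h : e.up n = false) :
    t q i * word q n = T q i * word q n - word q (e.σ n) := by
  have h1 := he (e.σ n) (by simp [e.up_σ, h])
  rw [e.σ_σ] at h1
  rw [T, add_mul, h1, ← mul_assoc (tInv q i), tInv_mul_t, one_mul, add_sub_cancel_right]

/-- The map from the regular representation to the algebra, inverse to acting on the basis
vector of index `0`. -/
noncomputable def fromRep : (ℤ →₀ (MvPolynomial (Fin 4) F)[T;T⁻¹]) →+ UDAHA q :=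
  Finsupp.liftAddHom fun n => (AddMonoidHom.mulRight (word q n)).comp (laurentHom q).toAddMonoidHom

theorem fromRep_single (n : ℤ) (f : (MvPolynomial (Fin 4) F)[T;T⁻¹]) :
    fromRep q (Finsupp.single n f) = laurentHom q f * word q n := by
  simp [fromRep]

/-- The operator was defined by the rules for left multiplication by `tᵢ`; since these rules hold in
the algebra, summing the coefficients intertwines the two. -/
theorem fromRep_op (D : DemazureData (MvPolynomial (Fin 4) F) (MvPolynomial (Fin 4) F)[T;T⁻¹])
    (e : EdgeInvolution) (i : Fin 4) (hc : D.c = MvPolynomial.X i)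
    (he : ∀ n, e.up n = true → word q (e.σ n) = t q i * word q n)
    (ht : ∀ f, t q i * laurentHom q f = laurentHom q (D.s f) * t q i + laurentHom q (D.δ f))
    (m : ℤ →₀ (MvPolynomial (Fin 4) F)[T;T⁻¹]) :
    fromRep q (D.op e m) = t q i * fromRep q m := by
  induction m using Finsupp.induction_linear with
  | zero => simp
  | add m m' h h' => simp only [map_add, h, h', mul_add]
  | single n f =>
    rw [fromRep_single, ← mul_assoc, ht, add_mul, mul_assoc]
    cases h : e.up n
    · rw [D.op_single_of_not_up' e h, map_add, map_add, fromRep_single, fromRep_single,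
        fromRep_single, t_mul_of_not_up q e i he h, map_mul, hc, ← C_eq_algebraMap,
        laurentHom_C_X, T_comm, mul_sub, mul_assoc, RingHom.map_neg_mul, ← sub_eq_add_neg]
    · rw [D.op_single_of_up e h, map_add, fromRep_single, fromRep_single, he n h]

theorem fromRep_coeffMul (f : (MvPolynomial (Fin 4) F)[T;T⁻¹])
    (m : ℤ →₀ (MvPolynomial (Fin 4) F)[T;T⁻¹]) :
    fromRep q (coeffMul (MvPolynomial (Fin 4) F) f m) = laurentHom q f * fromRep q m := by
  induction m using Finsupp.induction_linear with
  | zero => simp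
  | add m m' h h' => simp only [map_add, h, h', mul_add]
  | single n g => rw [coeffMul_single, fromRep_single, fromRep_single, map_mul, mul_assoc]

variable {q} in
theorem generator_induction {P : UDAHA q → Prop} (h : UDAHA q)
    (algebraMap : ∀ r, P (algebraMap F _ r)) (add : ∀ a b, P a → P b → P (a + b))
    (mul : ∀ a b, P a → P b → P (a * b)) (t : ∀ i, P (t q i)) (tInv : ∀ i, P (tInv q i)) : P h := by
  obtain ⟨x, rfl⟩ := RingQuot.mkAlgHom_surjective F (UDAHARel q) h
  induction x using FreeAlgebra.induction with
  | grade0 r => rw [AlgHom.commutes]; exact algebraMap r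
  | grade1 x =>
    cases x with
    | t i => exact t i
    | tInv i => exact tInv i
  | mul a b ha hb => rw [map_mul]; exact mul _ _ ha hb
  | add a b ha hb => rw [map_add]; exact add _ _ ha hb

/-- The elements whose action is intertwined by `fromRep` with left multiplication. -/
def Intertwined (h : UDAHA q) : Prop :=
  ∀ m, fromRep q (rep q hq0 h m) = h * fromRep q m

namespace Intertwined

variable {q hq0} {a b : UDAHA q}

theorem add (ha : Intertwined q hq0 a) (hb : Intertwined q hq0 b) :
    Intertwined q hq0 (a + b) := fun m => by
  rw [map_add, LinearMap.add_apply, map_add, ha, hb, add_mul]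

theorem mul (ha : Intertwined q hq0 a) (hb : Intertwined q hq0 b) :
    Intertwined q hq0 (a * b) := fun m => by
  rw [map_mul, Module.End.mul_apply, ha, hb, mul_assoc]

theorem laurentHom (f : (MvPolynomial (Fin 4) F)[T;T⁻¹]) :
    Intertwined q hq0 (laurentHom q f) := fun m => by
  rw [rep_laurentHom, fromRep_coeffMul]

theorem algebraMap (r : F) : Intertwined q hq0 (algebraMap F _ r) := by
  rw [← laurentHom_C_C]
  exact laurentHom _

theorem sub (ha : Intertwined q hq0 a) (hb : Intertwined q hq0 b) :
    Intertwined q hq0 (a - b) := by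
  have h := ha.add ((algebraMap (-1)).mul hb)
  rwa [add_algebraMap_neg_one_mul] at h

theorem of_T_sub {i : Fin 4} (ha : Intertwined q hq0 a) : Intertwined q hq0 (T q i - a) := by
  rw [← laurentHom_C_X]
  exact (laurentHom _).sub ha

end Intertwined

/-- Intertwined elements are closed under sums, products and `a ↦ Tᵢ - a`. Starting from `X`, `t₀`
and `t₁` these operations reach every generator, because `Tᵢ - tᵢ = tᵢ⁻¹`. -/
theorem fromRep_rep (h : UDAHA q) : Intertwined q hq0 h := by
  have hX : Intertwined q hq0 (t q 3 * t q 0) := by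
    rw [← laurentHom_T_one]; exact .laurentHom _
  have e : ∀ i, T q i - t q i = tInv q i := fun i => add_sub_cancel_left _ _
  have e' : ∀ i, T q i - tInv q i = t q i := fun i => add_sub_cancel_right _ _
  have h0 : Intertwined q hq0 (t q 0) := fun m => by
    rw [rep_t_zero]
    exact fromRep_op q _ _ 0 rfl (fun _ => word_even_σ q) (t_zero_mul_laurentHom q hq0) m
  have h1 : Intertwined q hq0 (t q 1) := fun m => by
    rw [rep_t_one]
    exact fromRep_op q _ _ 1 rfl (fun _ => word_odd_σ q) (t_one_mul_laurentHom q hq0) m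
  have h0' : Intertwined q hq0 (tInv q 0) := e 0 ▸ h0.of_T_sub
  have h1' : Intertwined q hq0 (tInv q 1) := e 1 ▸ h1.of_T_sub
  have h2' : Intertwined q hq0 (tInv q 2) := by
    rw [tInv_two q hq0]
    exact (Intertwined.algebraMap q).mul (hX.mul h1)
  have h2 : Intertwined q hq0 (t q 2) := e' 2 ▸ h2'.of_T_sub
  have h3 : Intertwined q hq0 (t q 3) := by
    have := hX.mul h0'
    rwa [mul_assoc, t_mul_tInv, mul_one] at this
  have h3' : Intertwined q hq0 (tInv q 3) := e 3 ▸ h3.of_T_sub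
  refine generator_induction h .algebraMap (fun _ _ => .add) (fun _ _ => .mul) ?_ ?_
  · exact fun | 0 => h0 | 1 => h1 | 2 => h2 | 3 => h3
  · exact fun | 0 => h0' | 1 => h1' | 2 => h2' | 3 => h3'

/-- This gives both the expansion `h = ∑ fₙ(X) wₙ` and the faithfulness of `rep`. -/
theorem fromRep_rep_single_zero (h : UDAHA q) :
    fromRep q (rep q hq0 h (Finsupp.single 0 1)) = h := by
  rw [fromRep_rep, fromRep_single, map_one, word_zero, mul_one, mul_one]

/-! ### Leading terms of `wₙ X` -/

/-- The leading coefficient of the product of a word with the variable. -/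
noncomputable def wordX (n : ℤ) : (MvPolynomial (Fin 4) F)[T;T⁻¹] :=
  if n % 2 = 0 then C (.C (q ^ n)) * LaurentPolynomial.T 1
  else C (.C (q ^ (n - 1))) * LaurentPolynomial.T (-1)

theorem wordX_of_even {n : ℤ} (h : n % 2 = 0) :
    wordX q n = C (.C (q ^ n)) * LaurentPolynomial.T 1 := if_pos h

theorem wordX_of_odd {n : ℤ} (h : n % 2 = 1) :
    wordX q n = C (.C (q ^ (n - 1))) * LaurentPolynomial.T (-1) := if_neg (by omega)

theorem data₀_s_wordX (n : ℤ) : (data₀ F).s (wordX q n) = wordX q (EdgeInvolution.even.σ n) := by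
  rcases Int.emod_two_eq_zero_or_one n with h | h
  · rw [show EdgeInvolution.even.σ n = n + 1 from if_pos h, wordX_of_even q h,
      wordX_of_odd q (by omega), add_sub_cancel_right]
    simp [data₀, demazureData]
  · rw [show EdgeInvolution.even.σ n = n - 1 from if_neg (by omega), wordX_of_odd q h,
      wordX_of_even q (by omega)]
    simp [data₀, demazureData]

theorem data₁_s_wordX (n : ℤ) :
    (data₁ q hq0).s (wordX q n) = wordX q (EdgeInvolution.odd.σ n) := by
  have hC : ∀ a, (data₁ q hq0).s (C a) = C a := reflect_C _
  have hT : (data₁ q hq0).s (LaurentPolynomial.T 1) = _ := reflect_T_one _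
  have hT' : (data₁ q hq0).s (LaurentPolynomial.T (-1)) = _ := reflect_T_neg_one _
  rcases Int.emod_two_eq_zero_or_one n with h | h
  · rw [show EdgeInvolution.odd.σ n = n - 1 from if_pos h, wordX_of_even q h,
      wordX_of_odd q (by omega), map_mul, hC, hT, coe_qInvSq, ← mul_assoc,
      ← map_mul, ← map_pow, ← map_mul, show n - 1 - 1 = n + -2 by ring, zpow_add₀ hq0,
      show q ^ (-2 : ℤ) = q⁻¹ ^ 2 by rw [zpow_neg, inv_pow, zpow_ofNat]]
  · rw [show EdgeInvolution.odd.σ n = n + 1 from if_neg (by omega), wordX_of_odd q h,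
      wordX_of_even q (by omega), map_mul, hC, hT', coe_inv_qInvSq,
      ← mul_assoc, ← map_mul, ← map_pow, ← map_mul, show n + 1 = n - 1 + 2 by ring, zpow_add₀ hq0,
      zpow_ofNat]

/-- Induction on the length: strip the leftmost letter, then `op_leading_term` applies its
reflection to the leading coefficient, which `data₀_s_wordX` or `data₁_s_wordX` computes. -/
theorem rep_word_single (n : ℤ) : ∃ m, rep q hq0 (word q n) (Finsupp.single 0 (.T 1)) =
    Finsupp.single n (wordX q n) + m ∧ ∀ k : ℤ, n.natAbs ≤ k.natAbs → m k = 0 := by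
  induction hN : n.natAbs generalizing n with
  | zero =>
    obtain rfl : n = 0 := by omega
    exact ⟨0, by simp [word_zero, wordX], by simp⟩
  | succ N ih =>
    rcases EdgeInvolution.not_up_even_or_odd (n := n) (by omega) with h | h
    · have hup : EdgeInvolution.even.up (EdgeInvolution.even.σ n) = true := by
        simp [EdgeInvolution.up_σ, h]
      have hn := EdgeInvolution.natAbs_even_σ hup
      have hw := word_even_σ q hup
      have hs := data₀_s_wordX q (EdgeInvolution.even.σ n)
      obtain ⟨m, hm, hm'⟩ := ih (EdgeInvolution.even.σ n) (by rw [EdgeInvolution.σ_σ] at hn; omega)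
      obtain ⟨m', h1, h2⟩ := (data₀ F).op_leading_term _
        (fun _ => EdgeInvolution.natAbs_even_σ) hup (wordX q (EdgeInvolution.even.σ n)) (m := m)
        (fun k hk => hm' k (by rw [EdgeInvolution.σ_σ] at hn; omega))
      rw [EdgeInvolution.σ_σ] at hw hs h1 h2
      refine ⟨m', ?_, fun k hk => h2 k (by omega)⟩
      rw [hw, map_mul, Module.End.mul_apply, hm, rep_t_zero, h1, hs]
    · have hup : EdgeInvolution.odd.up (EdgeInvolution.odd.σ n) = true := by
        simp [EdgeInvolution.up_σ, h]
      have hn := EdgeInvolution.natAbs_odd_σ hup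
      have hw := word_odd_σ q hup
      have hs := data₁_s_wordX q hq0 (EdgeInvolution.odd.σ n)
      obtain ⟨m, hm, hm'⟩ := ih (EdgeInvolution.odd.σ n) (by rw [EdgeInvolution.σ_σ] at hn; omega)
      obtain ⟨m', h1, h2⟩ := (data₁ q hq0).op_leading_term _
        (fun _ => EdgeInvolution.natAbs_odd_σ) hup (wordX q (EdgeInvolution.odd.σ n)) (m := m)
        (fun k hk => hm' k (by rw [EdgeInvolution.σ_σ] at hn; omega))
      rw [EdgeInvolution.σ_σ] at hw hs h1 h2
      refine ⟨m', ?_, fun k hk => h2 k (by omega)⟩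
      rw [hw, map_mul, Module.End.mul_apply, hm, rep_t_one, h1, hs]

end UDAHA

/-! ### Determination of the center -/

namespace UDAHA

open LaurentPolynomial

variable {F : Type*} [Field F] (q : F) (hq0 : q ≠ 0)

theorem zpow_eq_one_iff_of_not_root {q : F} (hq : ∀ n : ℕ, 0 < n → q ^ n ≠ 1)
    (n : ℤ) : q ^ n = 1 ↔ n = 0 := by
  refine ⟨fun h => ?_, fun h => by rw [h, zpow_zero]⟩
  by_contra hn
  refine hq n.natAbs (Int.natAbs_pos.mpr hn) ?_
  rcases Int.natAbs_eq n with h1 | h1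
  · rw [h1, zpow_natCast] at h; exact h
  · rw [h1, zpow_neg, zpow_natCast, inv_eq_one] at h; exact h

theorem wordX_ne {q : F} (hq : ∀ n : ℕ, 0 < n → q ^ n ≠ 1) {n : ℤ} (hn : n ≠ 0) :
    wordX q n ≠ LaurentPolynomial.T 1 := by
  intro h
  have h1 := congrArg (fun f : (MvPolynomial (Fin 4) F)[T;T⁻¹] => f.coeff 1) h
  have h2 : (LaurentPolynomial.T 1 : (MvPolynomial (Fin 4) F)[T;T⁻¹]).coeff 1 = 1 :=
    Finsupp.single_eq_same
  simp only [h2] at h1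
  rcases Int.emod_two_eq_zero_or_one n with h3 | h3
  · rw [wordX_of_even q h3, coeff_C_mul_T, if_pos rfl, ← map_one MvPolynomial.C] at h1
    exact hn ((zpow_eq_one_iff_of_not_root hq n).mp (MvPolynomial.C_injective _ _ h1))
  · rw [wordX_of_odd q h3, coeff_C_mul_T, if_neg (by omega)] at h1
    exact zero_ne_one h1

theorem rep_fromRep_apply (m v : ℤ →₀ (MvPolynomial (Fin 4) F)[T;T⁻¹]) (k : ℤ) :
    rep q hq0 (fromRep q m) v k = m.sum fun n f => f * rep q hq0 (word q n) v k := by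
  induction m using Finsupp.induction_linear with
  | zero => simp
  | add m m' h h' =>
    rw [map_add, map_add, LinearMap.add_apply, Finsupp.add_apply, h, h',
      Finsupp.sum_add_index' (by simp) (by intros; rw [add_mul])]
  | single n f =>
    rw [fromRep_single, map_mul, Module.End.mul_apply, rep_laurentHom,
      Finsupp.sum_single_index (by simp)]
    rfl

variable {q} in
-- At an index `N` of maximal length in the expansion of `z`, the equation `X z = z X` reads `X f_N
-- = (w_N · X) f_N`. Since `w_N · X ≠ X` and Laurent polynomials over `A` form a domain, `N ≠ 0`
-- would force `f_N = 0`.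
theorem rep_apply_eq_zero_of_mem_center (hq : ∀ n : ℕ, 0 < n → q ^ n ≠ 1) {z : UDAHA q}
    (hz : z ∈ Subalgebra.center F (UDAHA q)) {n : ℤ} (hn : n ≠ 0) :
    rep q hq0 z (Finsupp.single 0 1) n = 0 := by
  set m := rep q hq0 z (Finsupp.single 0 1) with hm
  by_contra hmn
  obtain ⟨N, hN, hmax⟩ := m.support.exists_max_image Int.natAbs ⟨n, Finsupp.mem_support_iff.mpr hmn⟩
  have hN0 : N ≠ 0 := by
    rintro rfl
    have := hmax n (Finsupp.mem_support_iff.mpr hmn)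
    omega
  have hcomm := congrArg (rep q hq0)
    (Subalgebra.mem_center_iff.mp hz (laurentHom q (LaurentPolynomial.T 1)))
  rw [map_mul, map_mul, rep_laurentHom] at hcomm
  have h1 := congrArg (fun f => f (Finsupp.single 0 1) N) hcomm
  simp only [Module.End.mul_apply, coeffMul_single, mul_one, ← hm] at h1
  -- After expanding `z` in words, only the term `k = N` contributes at index `N`: any other `wₖ X`
  -- has its leading term at `k ≠ N` and the rest in lengths below `|k| ≤ |N|`.
  rw [← fromRep_rep_single_zero q hq0 z, ← hm, rep_fromRep_apply, Finsupp.sum,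
    Finset.sum_eq_single N] at h1
  · obtain ⟨m', h2, h3⟩ := rep_word_single q hq0 N
    rw [h2, Finsupp.add_apply, h3 N le_rfl, add_zero, Finsupp.single_eq_same] at h1
    have h4 : (wordX q N - LaurentPolynomial.T 1) * m N = 0 := by
      rw [sub_mul, mul_comm, ← h1]
      exact sub_self _
    rcases mul_eq_zero.mp h4 with h5 | h5
    · exact wordX_ne hq hN0 (sub_eq_zero.mp h5)
    · exact Finsupp.mem_support_iff.mp hN h5
  · intro k hk hkN
    obtain ⟨m', h2, h3⟩ := rep_word_single q hq0 k
    rw [h2, Finsupp.add_apply, h3 N (hmax k hk), add_zero, Finsupp.single_eq_of_ne hkN.symm,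
      mul_zero]
  · exact fun h => absurd hN h

theorem exists_laurentHom_eq_of_mem_center {q : F} (hq0 : q ≠ 0) (hq : ∀ n : ℕ, 0 < n → q ^ n ≠ 1) {z : UDAHA q}
    (hz : z ∈ Subalgebra.center F (UDAHA q)) : ∃ f, laurentHom q f = z := by
  refine ⟨rep q hq0 z (Finsupp.single 0 1) 0, ?_⟩
  have h : rep q hq0 z (Finsupp.single 0 1) =
      Finsupp.single 0 (rep q hq0 z (Finsupp.single 0 1) 0) := by
    ext1 n
    rcases eq_or_ne n 0 with rfl | hn
    · rw [Finsupp.single_eq_same]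
    · rw [rep_apply_eq_zero_of_mem_center hq0 hq hz hn, Finsupp.single_eq_of_ne hn]
  conv_rhs => rw [← fromRep_rep_single_zero q hq0 z, h, fromRep_single, word_zero, mul_one]

/-- Applied to `1` at index `0`, `tᵢ f` and `f tᵢ` have coefficients `s f` and `f` at the one-letter
word `σ 0`; the `δ` terms stay at index `0`. -/
theorem s_eq_of_commute (D : DemazureData (MvPolynomial (Fin 4) F) (MvPolynomial (Fin 4) F)[T;T⁻¹])
    (e : EdgeInvolution) (i : Fin 4) (hi : rep q hq0 (t q i) = D.op e) (he : e.up 0 = true)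
    (he' : e.σ 0 ≠ 0) {f : (MvPolynomial (Fin 4) F)[T;T⁻¹]}
    (hf : t q i * laurentHom q f = laurentHom q f * t q i) : D.s f = f := by
  have h := congrArg (fun z => rep q hq0 z (Finsupp.single 0 1) (e.σ 0)) hf
  simp only [map_mul, Module.End.mul_apply, hi, rep_laurentHom, coeffMul_single, mul_one,
    D.op_single_of_up e he, map_add, map_one] at h
  simpa [Finsupp.single_apply, he', he'.symm] using h

/-- Invariance gives `fₖ = f₋ₖ` and `fₖ = q^{2k} f₋ₖ`, so a nonzero `fₖ` would force `q^{2k} = 1`.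
-/
theorem eq_C_of_s_eq {q : F} (hq0 : q ≠ 0) (hq : ∀ n : ℕ, 0 < n → q ^ n ≠ 1)
    {f : (MvPolynomial (Fin 4) F)[T;T⁻¹]}
    (h₀ : (data₀ F).s f = f) (h₁ : (data₁ q hq0).s f = f) : f = C (f.coeff 0) := by
  have hk : ∀ k : ℤ, k ≠ 0 → f.coeff k = 0 := by
    intro k hk
    have e0 := reflect_coeff 1 f k
    have e1 := reflect_coeff (qInvSq q hq0) f k
    rw [show reflect 1 f = f from h₀, one_zpow, Units.val_one, one_mul] at e0
    rw [show reflect (qInvSq q hq0) f = f from h₁, ← e0] at e1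
    by_contra hne
    have hu : ((qInvSq q hq0 ^ (-k) : (MvPolynomial (Fin 4) F)ˣ) : MvPolynomial (Fin 4) F) = 1 :=
      mul_right_cancel₀ hne (e1.symm.trans (one_mul _).symm)
    -- The unit comes from `F`, so the equation on its power can be read in `F`, where `q` has
    -- infinite order.
    have hmap : qInvSq q hq0 = Units.map
        (MvPolynomial.C : F →+* MvPolynomial (Fin 4) F).toMonoidHom (Units.mk0 q hq0 ^ (-2 : ℤ)) := by
      ext1
      rw [coe_qInvSq, ← map_pow]
      have h2 : ((Units.mk0 q hq0 ^ (-2 : ℤ) : Fˣ) : F) = q⁻¹ ^ 2 := by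
        rw [Units.val_zpow_eq_zpow_val, Units.val_mk0, zpow_neg, inv_pow, zpow_ofNat]
      exact congrArg MvPolynomial.C h2.symm
    rw [hmap, ← map_zpow, ← zpow_mul] at hu
    have hu' := MvPolynomial.C_injective (Fin 4) F (hu.trans (map_one MvPolynomial.C).symm)
    rw [Units.val_zpow_eq_zpow_val, Units.val_mk0, zpow_eq_one_iff_of_not_root hq] at hu'
    omega
  refine LaurentPolynomial.ext fun k => ?_
  have hC := coeff_C_mul_T (f.coeff 0) 0 k
  rw [T_zero, mul_one] at hC
  rw [hC]
  split_ifs with h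
  · rw [h]
  · exact hk k (Ne.symm h)

theorem polyToCenter_bijective {q : F} (hq0 : q ≠ 0) (hq : ∀ n : ℕ, 0 < n → q ^ n ≠ 1) :
    Function.Bijective (polyToCenter q) := by
  refine ⟨(injective_iff_map_eq_zero _).mpr fun a ha => ?_, fun z => ?_⟩
  · have h := congrArg (fun f => f (Finsupp.single 0 1)) (rep_polyToCenter q hq0 a)
    simp only [ha, coeffMul_single, mul_one] at h
    have h1 : (Finsupp.single 0 (C a) : ℤ →₀ (MvPolynomial (Fin 4) F)[T;T⁻¹]) = 0 := by
      rw [← h, Subalgebra.coe_zero, map_zero, LinearMap.zero_apply]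
    have h2 := congrArg (fun f : (MvPolynomial (Fin 4) F)[T;T⁻¹] => f.coeff 0)
      (Finsupp.single_eq_zero.mp h1)
    have hC := coeff_C_mul_T a 0 0
    rw [T_zero, mul_one, if_pos rfl] at hC
    exact hC.symm.trans h2
  · obtain ⟨z, hz⟩ := z
    obtain ⟨f, rfl⟩ := exists_laurentHom_eq_of_mem_center hq0 hq hz
    have hc := Subalgebra.mem_center_iff.mp hz
    have h := eq_C_of_s_eq hq0 hq
      (s_eq_of_commute q hq0 _ _ 0 (rep_t_zero q hq0) rfl (by decide) (hc _))
      (s_eq_of_commute q hq0 _ _ 1 (rep_t_one q hq0) rfl (by decide) (hc _))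
    refine ⟨f.coeff 0, Subtype.ext ?_⟩
    rw [← laurentHom_C, ← h]

/-! ### Monomial basis and conclusion -/

/-- The exponent vectors in four variables as quadruples. -/
noncomputable def exponentEquiv : (Fin 4 →₀ ℕ) ≃ ℕ × ℕ × ℕ × ℕ :=
  Finsupp.equivFunOnFinite.trans
    { toFun := fun v => (v 0, v 1, v 2, v 3)
      invFun := fun w => ![w.1, w.2.1, w.2.2.1, w.2.2.2]
      left_inv := fun v => by ext i; fin_cases i <;> rfl
      right_inv := fun _ => rfl }

theorem monomial_exponentEquiv_symm (l r s t : ℕ) :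
    MvPolynomial.monomial (exponentEquiv.symm (l, r, s, t)) (1 : F) =
      .X 0 ^ l * .X 1 ^ r * .X 2 ^ s * .X 3 ^ t := by
  rw [MvPolynomial.monomial_eq, map_one, one_mul,
    Finsupp.prod_fintype _ _ (fun _ => pow_zero _), Fin.prod_univ_four]
  rfl

end UDAHA

theorem theorem15p1 {F : Type*} [Field F] (q : F) (hq0 : q ≠ 0)
    (hq : ∀ n : ℕ, 0 < n → q ^ n ≠ 1) :
    Algebra.adjoin F (Set.range (UDAHA.T q)) = Subalgebra.center F (UDAHA q) ∧
    (∃ b : Module.Basis (ℕ × ℕ × ℕ × ℕ) F (Subalgebra.center F (UDAHA q)),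
      ∀ l r s t : ℕ, (b (l, r, s, t) : UDAHA q) =
        UDAHA.T q 0 ^ l * UDAHA.T q 1 ^ r * UDAHA.T q 2 ^ s * UDAHA.T q 3 ^ t) ∧
    (∃ e : Subalgebra.center F (UDAHA q) ≃ₐ[F] MvPolynomial (Fin 4) F,
      ∀ i : Fin 4, e ⟨UDAHA.T q i, UDAHA.T_mem_center q i⟩ = MvPolynomial.X i) := by
  have hbij := UDAHA.polyToCenter_bijective hq0 hq
  let e := AlgEquiv.ofBijective (UDAHA.polyToCenter q) hbij
  refine ⟨le_antisymm ?_ ?_, ⟨((MvPolynomial.basisMonomials (Fin 4) F).map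
    e.toLinearEquiv).reindex UDAHA.exponentEquiv, ?_⟩, e.symm, ?_⟩
  · rw [Algebra.adjoin_le_iff]
    rintro _ ⟨i, rfl⟩
    exact UDAHA.T_mem_center q i
  · intro z hz
    obtain ⟨a, ha⟩ := hbij.2 ⟨z, hz⟩
    obtain rfl : (UDAHA.polyToCenter q a : UDAHA q) = z := congrArg Subtype.val ha
    clear ha hz
    induction a using MvPolynomial.induction_on with
    | C r =>
      rw [← MvPolynomial.algebraMap_eq, AlgHom.commutes]
      exact Subalgebra.algebraMap_mem _ r
    | add a b ha hb =>
      rw [map_add, Subalgebra.coe_add]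
      exact Subalgebra.add_mem _ ha hb
    | mul_X a i ha =>
      rw [map_mul, Subalgebra.coe_mul, UDAHA.polyToCenter_X]
      exact Subalgebra.mul_mem _ ha (Algebra.subset_adjoin ⟨i, rfl⟩)
  · intro l r s t
    rw [Module.Basis.reindex_apply, Module.Basis.map_apply, MvPolynomial.coe_basisMonomials]
    change (UDAHA.polyToCenter q (MvPolynomial.monomial _ 1) : UDAHA q) = _
    simp only [UDAHA.monomial_exponentEquiv_symm]
    simp only [map_mul, map_pow, Subalgebra.coe_mul, Subalgebra.coe_pow, UDAHA.polyToCenter_X]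
  · intro i
    rw [AlgEquiv.symm_apply_eq]
    exact Subtype.ext (UDAHA.polyToCenter_X q i).symm
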